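/- Let $(\bm X_i)_{i\in\mathbb Z}$ be a strictly stationary sequence of $d$-dimensional random vectors on a probability space $(\Omega,\mathcal A,\Pr)$, such that the distribution function $F$ of $\bm X_1$ has continuous univariate margins $F_1,\dots,F_d$, and let $C$ be the copula of $F$, i.e. $F(\bm x)=C\{F_1(x_1),\dots,F_d(x_d)\}$ for all $\bm x\in\mathbb R^d$. For a sample $\bm x=(\bm x_1,\dots,\bm x_m)\in(\mathbb R^d)^m$, $m\ge 1$, let $R_{ij}=\sum_{t=1}^m\mathbf 1(x_{tj}\le x_{ij})$ and let $C_{\bm x}(\bm u)=\frac1m\sum_{i=1}^m\prod_{j=1}^d\mathbf 1(R_{ij}/m\le u_j)$ be its empirical copula. For every such $m$, $\bm x$ and every $\bm u\in[0,1]^d$ let $\nu_{\bm u}^{\bm x}$ be a Borel probability measure on $[0,1]^d$ with mean $\bm u$ (the smoothing law), let $\bm W_{\bm u}^{\bm x}$ be a random vector with law $\nu_{\bm u}^{\bm x}$, with components $W_{1,u_1}^{\bm x},\dots,W_{d,u_d}^{\bm x}$, and put $C_{\bm x}^\nu(\bm u)=\int_{[0,1]^d}C_{\bm x}(\bm w)\,\mathrm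 d\nu_{\bm u}^{\bm x}(\bm w)$. For integers $1\le k\le l$ write $C_{k:l}$ and $C_{k:l}^\nu$ for $C_{\bm x}$ and $C_{\bm x}^\nu$ with $\bm x=(\bm X_k,\dots,\bm X_l)$, and put $C_{k:l}=C_{k:l}^\nu=0$ if $k>l$. Let $\Delta=\{(s,t)\in[0,1]^2:s\le t\}$, $\lambda_n(s,t)=(\lfloor nt\rfloor-\lfloor ns\rfloor)/n$ and, for $(s,t)\in\Delta$, $\bm u\in[0,1]^d$, $$\mathbb C_n(s,t,\bm u)=\sqrt n\,\lambda_n(s,t)\{C_{\lfloor ns\rfloor+1:\lfloor nt\rfloor}(\bm u)-C(\bm u)\},\qquad \mathbb C_n^\nu(s,t,\bm u)=\sqrt n\,\lambda_n(s,t)\{C^\nu_{\lfloor ns\rfloor+1:\lfloor nt\rfloor}(\bm u)-C(\bm u)\}.$$ Let $\ell^\infty(\Delta\times[0,1]^d)$ be the space of bounded real functions with the supremum norm, and let $\leadsto$ denote weak convergence in the sense of Hoffmann-Jørgensen: $Y_n\leadsto Y$ means that $Y$ is Borel measurable and $\mathrm E^*f(Y_n)\to\mathrm E f(Y)$ for every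 bounded continuous real function $f$, with $\mathrm E^*$ the outer expectation. Assume that (a) for every $j\in\{1,\dots,d\}$, the partial derivative $\dot C_j=\partial C/\partial u_j$ exists and is continuous on $\{\bm u\in[0,1]^d:u_j\in(0,1)\}$; (b) there is a constant $\kappa>0$ such that $\mathrm{Var}(W_{j,u_j}^{\bm x})\le\kappa u_j(1-u_j)/n$ for all $n\ge 1$, $\bm x\in(\mathbb R^d)^n$, $\bm u\in[0,1]^d$ and $j\in\{1,\dots,d\}$; (c) $\mathbb C_n\leadsto\mathbb C_C$ in $\ell^\infty(\Delta\times[0,1]^d)$, where $\mathbb C_C$ has almost surely continuous trajectories. Then $$\sup_{(s,t)\in\Delta,\ \bm u\in[0,1]^d}\bigl|\mathbb C_n^\nu(s,t,\bm u)-\mathbb C_n(s,t,\bm u)\bigr|\to 0\quad\text{in outer probability as }n\to\infty,$$ and $\mathbb C_n^\nu\leadsto\mathbb C_C$ in $\ell^\infty(\Delta\times[0,1]^d)$. -/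

import Mathlib

open MeasureTheory ProbabilityTheory Filter Topology
open scoped ENNReal BoundedContinuousFunction

noncomputable section

namespace SmoothCopula

/-- The unit cube `[0,1]^d`. -/
def cube (d : ℕ) : Set (Fin d → ℝ) := Set.Icc 0 1

/-- `Δ = {(s,t) ∈ [0,1]² : s ≤ t}`. -/
def Delta : Set (ℝ × ℝ) := {p | 0 ≤ p.1 ∧ p.1 ≤ p.2 ∧ p.2 ≤ 1}

/-- The index set `Δ × [0,1]^d` of the processes. -/
abbrev Idx (d : ℕ) : Type := ↥Delta × ↥(cube d)

/-- `ℓ^∞(T)`: all bounded real functions on `T`, with the supremum norm. -/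
abbrev LInf (T : Type*) : Type _ := ↥(lp (fun _ : T => ℝ) ∞)

/-! ### Copulas -/

/-- A `d`-dimensional copula, given through the probability law on `ℝ^d` with standard uniform
univariate margins of which it is the distribution function. -/
structure Copula (d : ℕ) where
  /-- The law with distribution function the copula. -/
  law : Measure (Fin d → ℝ)
  isProb : IsProbabilityMeasure law
  margin : ∀ j : Fin d, law.map (fun w => w j) = volume.restrict (Set.Icc (0 : ℝ) 1)

/-- A copula as a function: the distribution function `u ↦ P(V ≤ u)` of its law. -/
instance (d : ℕ) : CoeFun (Copula d) (fun _ => (Fin d → ℝ) → ℝ) :=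
  ⟨fun C u => C.law.real (Set.Iic u)⟩

/-- For every `j`, the partial derivative `∂C/∂u_j` exists and is continuous on
`{u ∈ [0,1]^d : u_j ∈ (0,1)}`. -/
def HasSmoothPartials {d : ℕ} (C : Copula d) : Prop :=
  ∀ j : Fin d, ∃ D : (Fin d → ℝ) → ℝ,
    (∀ u ∈ cube d, u j ∈ Set.Ioo (0 : ℝ) 1 →
      HasDerivAt (fun r : ℝ => C (Function.update u j r)) (D u) (u j)) ∧
    ContinuousOn D {u | u ∈ cube d ∧ u j ∈ Set.Ioo (0 : ℝ) 1}

/-! ### The observations -/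

/-- Strict stationarity of a time series indexed by `ℤ`: the law of the whole series
is invariant under all time shifts. -/
def IsStationary {Ω S : Type*} [MeasurableSpace Ω] [MeasurableSpace S] (P : Measure Ω)
    (X : ℤ → Ω → S) : Prop :=
  ∀ h : ℤ, P.map (fun ω (i : ℤ) => X (i + h) ω) = P.map (fun ω (i : ℤ) => X i ω)

/-- The stretch `(X_k, …, X_l)`, of length `l - k + 1`; it is empty if `k > l`. -/
def stretch {Ω S : Type*} (X : ℤ → Ω → S) (k l : ℕ) (ω : Ω) : Fin (l + 1 - k) → S :=
  fun i => X ((k + (i : ℕ) : ℕ) : ℤ) ω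

/-! ### Empirical copulas -/

/-- The maximal rank of `x_{ij}` among `x_{1j}, …, x_{mj}`. -/
def rank {d m : ℕ} (x : Fin m → Fin d → ℝ) (i : Fin m) (j : Fin d) : ℕ :=
  (Finset.univ.filter fun t : Fin m => x t j ≤ x i j).card

/-- The empirical copula of the sample `x` of size `m`; it is `0` for the empty sample. -/
def empCopula {d m : ℕ} (x : Fin m → Fin d → ℝ) (u : Fin d → ℝ) : ℝ :=
  (1 / (m : ℝ)) * ∑ i : Fin m, if ∀ j, (rank x i j : ℝ) / (m : ℝ) ≤ u j then (1 : ℝ) else 0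

/-- A family of smoothing laws `ν_u^x` on `[0,1]^d` with mean `u`, one for every sample `x` of
size `m ≥ 1` and every `u ∈ [0,1]^d` (the values for other arguments are irrelevant). -/
structure SmoothingFamily (d : ℕ) where
  /-- The smoothing laws. -/
  law : (m : ℕ) → (Fin m → Fin d → ℝ) → (Fin d → ℝ) → Measure (Fin d → ℝ)
  isProb : ∀ m, 1 ≤ m → ∀ x, ∀ u ∈ cube d, IsProbabilityMeasure (law m x u)
  support : ∀ m, 1 ≤ m → ∀ x, ∀ u ∈ cube d, ∀ᵐ w ∂(law m x u), w ∈ cube d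
  mean : ∀ m, 1 ≤ m → ∀ x, ∀ u ∈ cube d, ∀ j, ∫ w, w j ∂(law m x u) = u j

/-- There is `κ > 0` with `Var(W_{j,u_j}^x) ≤ κ u_j (1 - u_j) / m` for all samples `x` of any
size `m ≥ 1`, all `u ∈ [0,1]^d` and all `j`, where `W_u^x` has law `ν_u^x`. -/
def VarianceCondition {d : ℕ} (ν : SmoothingFamily d) : Prop :=
  ∃ κ : ℝ, 0 < κ ∧ ∀ m : ℕ, 1 ≤ m → ∀ x : Fin m → Fin d → ℝ, ∀ u ∈ cube d, ∀ j : Fin d,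
    variance (fun w : Fin d → ℝ => w j) (ν.law m x u) ≤ κ * u j * (1 - u j) / m

/-- The smooth empirical copula `u ↦ ∫ C_x(w) dν_u^x(w)`, where `C_x` is the empirical copula;
it is `0` for the empty sample. -/
def smoothEmpCopula {d m : ℕ} (ν : SmoothingFamily d) (x : Fin m → Fin d → ℝ)
    (u : Fin d → ℝ) : ℝ :=
  ∫ w, empCopula x w ∂(ν.law m x u)

/-! ### Sequential processes -/

/-- `λ_n(s,t) = (⌊nt⌋ - ⌊ns⌋) / n`. -/
def lam (n : ℕ) (s t : ℝ) : ℝ := ((⌊n * t⌋₊ : ℝ) - (⌊n * s⌋₊ : ℝ)) / n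

theorem abs_empCopula_le {d m : ℕ} (x : Fin m → Fin d → ℝ) (u : Fin d → ℝ) :
    |empCopula x u| ≤ 1 := by
  unfold empCopula
  set S := ∑ i : Fin m, if ∀ j, (rank x i j : ℝ) / (m : ℝ) ≤ u j then (1 : ℝ) else 0 with hS
  have h0 : 0 ≤ S := Finset.sum_nonneg fun i _ => by split_ifs <;> norm_num
  have h1 : S ≤ m := by
    calc S ≤ ∑ _i : Fin m, (1 : ℝ) :=
          Finset.sum_le_sum fun i _ => by split_ifs <;> norm_num
      _ = m := by simp
  rw [abs_of_nonneg (by positivity), one_div, inv_mul_eq_div]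
  exact div_le_one_of_le₀ h1 (Nat.cast_nonneg m)

theorem abs_smoothEmpCopula_le {d m : ℕ} (ν : SmoothingFamily d) (x : Fin m → Fin d → ℝ)
    {u : Fin d → ℝ} (hu : u ∈ cube d) : |smoothEmpCopula ν x u| ≤ 1 := by
  unfold smoothEmpCopula
  rcases Nat.eq_zero_or_pos m with rfl | hm
  · simp [empCopula]
  · have := ν.isProb m hm x u hu
    have h := norm_integral_le_of_norm_le_const (μ := ν.law m x u) (f := empCopula x) (C := 1)
      (Eventually.of_forall fun w => abs_empCopula_le x w)
    simpa using h

theorem abs_lam_le (n : ℕ) (p : ↥Delta) : |lam n p.1.1 p.1.2| ≤ 1 := by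
  obtain ⟨⟨s, t⟩, hs, hst, ht⟩ := p
  simp only at hs hst ht ⊢
  have hn : (0 : ℝ) ≤ n := Nat.cast_nonneg n
  have h1 : (⌊(n : ℝ) * s⌋₊ : ℝ) ≤ ⌊(n : ℝ) * t⌋₊ := by
    exact_mod_cast Nat.floor_le_floor (mul_le_mul_of_nonneg_left hst hn)
  have h2 : (⌊(n : ℝ) * t⌋₊ : ℝ) ≤ n :=
    (Nat.floor_le (mul_nonneg hn (hs.trans hst))).trans (mul_le_of_le_one_right hn ht)
  have h3 : (0 : ℝ) ≤ ⌊(n : ℝ) * s⌋₊ := Nat.cast_nonneg _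
  unfold lam
  rw [abs_of_nonneg (div_nonneg (by linarith) hn)]
  exact div_le_one_of_le₀ (by linarith) hn

theorem memlp_seq {d : ℕ} (n : ℕ) (C : Copula d) (A : Idx d → ℝ) (hA : ∀ τ, |A τ| ≤ 1) :
    Memℓp (fun τ : Idx d =>
      Real.sqrt n * lam n τ.1.1.1 τ.1.1.2 * (A τ - C τ.2.1)) ∞ := by
  refine memℓp_infty ⟨Real.sqrt n * 1 * 2, ?_⟩
  rintro _ ⟨τ, rfl⟩
  have := C.isProb
  have hC0 : 0 ≤ C.law.real (Set.Iic τ.2.1) := measureReal_nonneg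
  have hC1 : C.law.real (Set.Iic τ.2.1) ≤ 1 := measureReal_le_one
  have hd : |A τ - C τ.2.1| ≤ 2 := by
    have := abs_le.1 (hA τ)
    rw [abs_le]; constructor <;> linarith
  simp only [Real.norm_eq_abs, abs_mul, abs_of_nonneg (Real.sqrt_nonneg _)]
  have := abs_lam_le n τ.1
  gcongr

/-- The two-sided sequential empirical copula process
`(s,t,u) ↦ √n λ_n(s,t) {C_{⌊ns⌋+1:⌊nt⌋}(u) - C(u)}`, as an element of `ℓ^∞(Δ × [0,1]^d)`. -/
def seqEmpCop {d : ℕ} {Ω : Type*} (X : ℤ → Ω → Fin d → ℝ) (C : Copula d) (n : ℕ) (ω : Ω) :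
    LInf (Idx d) :=
  ⟨fun τ => Real.sqrt n * lam n τ.1.1.1 τ.1.1.2 *
      (empCopula (stretch X (⌊n * τ.1.1.1⌋₊ + 1) ⌊n * τ.1.1.2⌋₊ ω) τ.2.1 - C τ.2.1),
    memlp_seq n C _ fun _ => abs_empCopula_le _ _⟩

/-- The smooth two-sided sequential empirical copula process
`(s,t,u) ↦ √n λ_n(s,t) {C^ν_{⌊ns⌋+1:⌊nt⌋}(u) - C(u)}`, as an element of `ℓ^∞(Δ × [0,1]^d)`. -/
def seqSmoothCop {d : ℕ} {Ω : Type*} (X : ℤ → Ω → Fin d → ℝ) (C : Copula d)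
    (ν : SmoothingFamily d) (n : ℕ) (ω : Ω) : LInf (Idx d) :=
  ⟨fun τ => Real.sqrt n * lam n τ.1.1.1 τ.1.1.2 *
      (smoothEmpCopula ν (stretch X (⌊n * τ.1.1.1⌋₊ + 1) ⌊n * τ.1.1.2⌋₊ ω) τ.2.1 - C τ.2.1),
    memlp_seq n C _ fun τ => abs_smoothEmpCopula_le ν _ τ.2.2⟩

/-! ### Weak convergence of arbitrary (not necessarily measurable) maps -/

/-- Outer expectation `E^* f = inf {E g : g ≥ f, g measurable and integrable}` (used for
bounded `f`). -/
def outerExpectation {Ω : Type*} [MeasurableSpace Ω] (P : Measure Ω) (f : Ω → ℝ) : ℝ :=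
  sInf {r : ℝ | ∃ g : Ω → ℝ, Measurable g ∧ Integrable g P ∧ (∀ ω, f ω ≤ g ω) ∧ r = ∫ ω, g ω ∂P}

/-- `Y_n ⇝ Z` in the metric space `E`, in the sense of Hoffmann-Jørgensen: `Z` is Borel measurable
and `E^* f(Y_n) → E f(Z)` for all bounded continuous `f : E → ℝ`. -/
def WeakConv {Ω Ω' E : Type*} [MeasurableSpace Ω] [MeasurableSpace Ω'] [TopologicalSpace E]
    (P : Measure Ω) (Y : ℕ → Ω → E) (P' : Measure Ω') (Z : Ω' → E) : Prop :=
  @Measurable Ω' E _ (borel E) Z ∧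
  ∀ f : E →ᵇ ℝ, Tendsto (fun n => outerExpectation P (fun ω => f (Y n ω))) atTop
    (𝓝 (∫ ω', f (Z ω') ∂P'))

end SmoothCopula

end

/-! On a stretch of `m ≤ n` observations the scaling factor is `√n λ_n = m/√n`, and the smoothing
error splits as `C^ν - C_x = ∫ {(C_x - C)(w) - (C_x - C)(u)} dν + ∫ {C(w) - C(u)} dν`
(`smoothEmpCopula_sub_eq`).

The first integral is stochastic. Multiplied by `m/√n`, its part over `dist w u ≤ δ` is at most the
modulus of continuity of the unsmoothed process, while the rest costs `O(1/√n)` by Chebyshev's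
inequality (`abs_integral_centred_le`). Since the weak limit has continuous paths on a compact index
set, the modulus is small with high outer probability (`WeakConv.exists_modulus_lt`).

The second integral is a deterministic bias. A Lipschitz bound alone would only give `O(1/√m)`,
which is not enough. Away from the faces of the cube, `C` is linear up to a small relative error,
and the linear part integrates to zero because `ν` has mean `u`; near the faces no derivative is
needed, because the variance factor `u_j (1 - u_j)` is itself small. `exists_linear_approx` treats
both regimes at once, and `eventually_bias_le` integrates it.

Together these bound the uniform distance of the two processes (`eventually_abs_sub_le`). A Slutsky
argument for outer expectations then transfers the weak limit (`WeakConv.of_dist_tendsto`). -/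

noncomputable section

namespace SmoothCopula

/-! ### Outer expectations -/

section Outer

variable {Ω : Type*} [MeasurableSpace Ω] {P : Measure Ω} [IsProbabilityMeasure P]

theorem outerExpectation_le {f g : Ω → ℝ} {B : ℝ} (hf : ∀ ω, |f ω| ≤ B) (hg : Measurable g)
    (hgi : Integrable g P) (hfg : ∀ ω, f ω ≤ g ω) : outerExpectation P f ≤ ∫ ω, g ω ∂P := by
  refine csInf_le ⟨-B, ?_⟩ ⟨g, hg, hgi, hfg, rfl⟩
  rintro _ ⟨h, -, hhi, hfh, rfl⟩
  have := integral_mono (μ := P) (integrable_const (-B)) hhi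
    fun ω => (abs_le.1 (hf ω)).1.trans (hfh ω)
  simpa using this

theorem outerExpectation_set_nonempty {f : Ω → ℝ} {B : ℝ} (hf : ∀ ω, |f ω| ≤ B) :
    {r : ℝ | ∃ g : Ω → ℝ, Measurable g ∧ Integrable g P ∧ (∀ ω, f ω ≤ g ω) ∧
      r = ∫ ω, g ω ∂P}.Nonempty :=
  ⟨_, fun _ => B, measurable_const, integrable_const _, fun ω => (abs_le.1 (hf ω)).2, rfl⟩

/-- A nearly optimal majorant `g` of `f₂` gives the majorant `g + r + 2B·1_A` of `f₁`: on `A`, `g ≥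
-B` and `f₁ ≤ B`. The set `A` need not be measurable, so its measurable hull, of equal measure,
replaces it. -/
theorem outerExpectation_le_add {f₁ f₂ : Ω → ℝ} {A : Set Ω} {B r : ℝ}
    (hf₁ : ∀ ω, |f₁ ω| ≤ B) (hf₂ : ∀ ω, |f₂ ω| ≤ B) (h : ∀ ω ∉ A, f₁ ω ≤ f₂ ω + r)
    (hr : 0 ≤ r) :
    outerExpectation P f₁ ≤ outerExpectation P f₂ + r + 2 * B * P.real A := by
  refine le_of_forall_pos_le_add fun η hη => ?_
  obtain ⟨_, ⟨g, hg, hgi, hfg, rfl⟩, hlt⟩ :=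
    exists_lt_of_csInf_lt (outerExpectation_set_nonempty (P := P) hf₂)
      (show outerExpectation P f₂ < outerExpectation P f₂ + η by linarith)
  have hm := measurableSet_toMeasurable P A
  have hind : Integrable ((toMeasurable P A).indicator fun _ => 2 * B) P :=
    (integrable_const _).indicator hm
  have key := outerExpectation_le (P := P) (f := f₁)
    (g := fun ω => g ω + r + (toMeasurable P A).indicator (fun _ => 2 * B) ω) hf₁
    ((hg.add measurable_const).add (measurable_const.indicator hm))
    ((hgi.add (integrable_const r)).add hind) (fun ω => by
      by_cases hω : ω ∈ toMeasurable P A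
      · have h1 := abs_le.1 (hf₁ ω)
        have h2 := abs_le.1 (hf₂ ω)
        have h3 := hfg ω
        simp only [Set.indicator_of_mem hω]
        linarith
      · have h1 := h ω fun hA => hω (subset_toMeasurable P A hA)
        have h3 := hfg ω
        simp only [Set.indicator_of_notMem hω]
        linarith)
  have hA : P.real (toMeasurable P A) = P.real A := by
    simp [measureReal_def, measure_toMeasurable]
  rw [integral_add (f := fun ω => g ω + r) (hgi.add (integrable_const r)) hind,
    integral_add hgi (integrable_const r),
    integral_indicator_const _ hm, hA] at key
  simp only [integral_const, probReal_univ, smul_eq_mul] at key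
  linarith

/-- Markov's inequality, applied to every measurable majorant of `f`; `P.real A` is an outer
probability here. -/
theorem measureReal_le_outerExpectation {f : Ω → ℝ} {A : Set Ω} {B : ℝ} (hf : ∀ ω, |f ω| ≤ B)
    (hf0 : ∀ ω, 0 ≤ f ω) (hA : ∀ ω ∈ A, 1 ≤ f ω) : P.real A ≤ outerExpectation P f := by
  refine le_csInf (outerExpectation_set_nonempty hf) ?_
  rintro _ ⟨g, -, hgi, hfg, rfl⟩
  have h1 := mul_meas_ge_le_integral_of_nonneg (μ := P)
    (Eventually.of_forall fun ω => (hf0 ω).trans (hfg ω)) hgi 1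
  rw [one_mul] at h1
  exact (measureReal_mono fun ω hω => (hA ω hω).trans (hfg ω)).trans h1

end Outer

/-! ### Lipschitz envelopes and Slutsky's lemma -/

section Envelope

variable {E : Type*} [PseudoMetricSpace E]

/-- The least `k`-Lipschitz majorant of a bounded continuous function. -/
def lipMajorant (f : E →ᵇ ℝ) (k : ℕ) (x : E) : ℝ := ⨆ y, (f y - k * dist x y)

variable (f : E →ᵇ ℝ) (k : ℕ)

theorem sub_mul_dist_le_norm (x y : E) : f y - k * dist x y ≤ ‖f‖ := by
  have h1 := (abs_le.1 (f.norm_coe_le_norm y)).2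
  have h2 : 0 ≤ (k : ℝ) * dist x y := by positivity
  linarith

theorem sub_mul_dist_le_lipMajorant (x y : E) : f y - k * dist x y ≤ lipMajorant f k x :=
  le_ciSup (f := fun y => f y - k * dist x y)
    ⟨‖f‖, by rintro _ ⟨y, rfl⟩; exact sub_mul_dist_le_norm f k x y⟩ y

theorem le_lipMajorant (x : E) : f x ≤ lipMajorant f k x := by
  simpa using sub_mul_dist_le_lipMajorant f k x x

theorem abs_lipMajorant_le (x : E) : |lipMajorant f k x| ≤ ‖f‖ := by
  have : Nonempty E := ⟨x⟩
  refine abs_le.2 ⟨?_, ciSup_le fun y => sub_mul_dist_le_norm f k x y⟩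
  exact (abs_le.1 (f.norm_coe_le_norm x)).1.trans (le_lipMajorant f k x)

theorem lipMajorant_le_add (x z : E) :
    lipMajorant f k x ≤ lipMajorant f k z + k * dist x z := by
  have : Nonempty E := ⟨x⟩
  refine ciSup_le fun y => ?_
  have h1 := sub_mul_dist_le_lipMajorant f k z y
  have h2 := mul_le_mul_of_nonneg_left (dist_triangle z x y) (Nat.cast_nonneg (α := ℝ) k)
  rw [dist_comm z x] at h2
  linarith

theorem continuous_lipMajorant : Continuous (lipMajorant f k) :=
  (LipschitzWith.of_le_add_mul (k : NNReal) fun x z => by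
    simpa using lipMajorant_le_add f k x z).continuous

/-- The Lipschitz majorant as a bounded continuous function. -/
def lipMajorantBCF : E →ᵇ ℝ :=
  BoundedContinuousFunction.ofNormedAddCommGroup (lipMajorant f k)
    (continuous_lipMajorant f k) ‖f‖ (abs_lipMajorant_le f k)

/-- Points farther than `δ` from `x` pay a penalty of at least `2‖f‖` once `k` is large, so only
values of `f` near `x` can matter. -/
theorem tendsto_lipMajorant (x : E) :
    Tendsto (fun k : ℕ => lipMajorant f k x) atTop (𝓝 (f x)) := by
  have : Nonempty E := ⟨x⟩
  rw [Metric.tendsto_atTop]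
  intro ε hε
  obtain ⟨δ, hδ, hfδ⟩ := Metric.continuousAt_iff.1 f.continuous.continuousAt (ε / 2) (half_pos hε)
  obtain ⟨N, hN⟩ := exists_nat_ge (2 * ‖f‖ / δ)
  refine ⟨N, fun k hk => ?_⟩
  have hk' : 2 * ‖f‖ ≤ k * δ := by
    rw [div_le_iff₀ hδ] at hN
    exact hN.trans (by gcongr)
  have hle : lipMajorant f k x ≤ f x + ε / 2 := by
    refine ciSup_le fun y => ?_
    have h0 : 0 ≤ (k : ℝ) * dist x y := by positivity
    rcases lt_or_ge (dist y x) δ with h | h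
    · have := hfδ h
      rw [Real.dist_eq, abs_lt] at this
      linarith
    · rw [dist_comm] at h
      have h1 := mul_le_mul_of_nonneg_left h (Nat.cast_nonneg (α := ℝ) k)
      have h2 := (abs_le.1 (f.norm_coe_le_norm y)).2
      have h3 := (abs_le.1 (f.norm_coe_le_norm x)).1
      linarith
  rw [Real.dist_eq, abs_of_nonneg (by linarith [le_lipMajorant f k x])]
  linarith

variable {Ω Ω' : Type*} [MeasurableSpace Ω] [MeasurableSpace Ω'] {P : Measure Ω}
  [IsProbabilityMeasure P] {P' : Measure Ω'} [IsProbabilityMeasure P']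

omit [IsProbabilityMeasure P'] in
theorem aestronglyMeasurable_comp_of_borel {Z : Ω' → E} (hZ : @Measurable Ω' E _ (borel E) Z)
    {g : E → ℝ} (hg : Continuous g) : AEStronglyMeasurable (fun ω => g (Z ω)) P' := by
  let : MeasurableSpace E := borel E
  have : BorelSpace E := ⟨rfl⟩
  exact (hg.measurable.comp hZ).aestronglyMeasurable

theorem tendsto_integral_lipMajorant {Z : Ω' → E} (hZ : @Measurable Ω' E _ (borel E) Z) :
    Tendsto (fun k : ℕ => ∫ ω, lipMajorant f k (Z ω) ∂P') atTop (𝓝 (∫ ω, f (Z ω) ∂P')) :=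
  tendsto_integral_of_dominated_convergence (fun _ => ‖f‖)
    (fun k => aestronglyMeasurable_comp_of_borel hZ (continuous_lipMajorant f k))
    (integrable_const _) (fun k => Eventually.of_forall fun _ => abs_lipMajorant_le f k _)
    (Eventually.of_forall fun _ => tendsto_lipMajorant f _)

/-- If `dist (Y n) (Y' n)` tends to `0` in outer probability and `Y n ⇝ Z`, then `Y' n ⇝ Z`. -/
theorem WeakConv.of_dist_tendsto {Y Y' : ℕ → Ω → E} {Z : Ω' → E} (hY : WeakConv P Y P' Z)
    (h : ∀ ε : ℝ, 0 < ε → Tendsto (fun n => P.real {ω | ε < dist (Y' n ω) (Y n ω)}) atTop (𝓝 0)) :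
    WeakConv P Y' P' Z := by
  -- A continuous `f` need not be uniformly continuous, so it is replaced by Lipschitz functions:
  -- for the lower bound by the minorant `-lipMajorant (-f) k`, for the upper bound by `lipMajorant
  -- f k`. Their expectations at `Z` approach that of `f`.
  refine ⟨hY.1, fun f => tendsto_order.2 ⟨fun a ha => ?_, fun a ha => ?_⟩⟩
  · have hlim := (tendsto_integral_lipMajorant (P' := P') (-f) hY.1).neg
    simp only [BoundedContinuousFunction.coe_neg, Pi.neg_apply, integral_neg, neg_neg] at hlim
    obtain ⟨k, hk⟩ := (hlim.eventually (lt_mem_nhds ha)).exists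
    rw [← integral_neg] at hk
    set b := ∫ ω, -lipMajorant (-f) k (Z ω) ∂P' with hb
    -- A shift of size `ε` moves a `k`-Lipschitz function by at most `k * ε`, less than half of the
    -- gap available.
    obtain ⟨ε, hε, hkε⟩ : ∃ ε : ℝ, 0 < ε ∧ k * ε < (b - a) / 2 := by
      refine ⟨(b - a) / (2 * (k + 1)), by have := sub_pos.2 hk; positivity, ?_⟩
      have h0 : (0 : ℝ) < b - a := sub_pos.2 hk
      rw [← mul_div_assoc, div_lt_div_iff₀ (by positivity) (by norm_num)]
      nlinarith
    have h1 := hY.2 (-lipMajorantBCF (-f) k)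
    have h2 := h1.sub ((h ε hε).const_mul (2 * ‖f‖))
    have h3 : (a + b) / 2 < b - 2 * ‖f‖ * 0 := by linarith
    filter_upwards [h2.eventually (lt_mem_nhds h3)] with n hn
    have := outerExpectation_le_add (P := P) (A := {ω | ε < dist (Y' n ω) (Y n ω)})
      (f₁ := fun ω => (-lipMajorantBCF (-f) k) (Y n ω)) (f₂ := fun ω => f (Y' n ω))
      (r := k * ε)
      (fun ω => by
        simpa [lipMajorantBCF] using abs_lipMajorant_le (-f) k (Y n ω))
      (fun ω => f.norm_coe_le_norm _)
      (fun ω hω => by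
        have e1 := lipMajorant_le_add (-f) k (Y' n ω) (Y n ω)
        have e2 := le_lipMajorant (-f) k (Y' n ω)
        have e3 := mul_le_mul_of_nonneg_left (not_lt.1 hω) (Nat.cast_nonneg (α := ℝ) k)
        simp only [BoundedContinuousFunction.coe_neg, Pi.neg_apply, lipMajorantBCF,
          BoundedContinuousFunction.coe_ofNormedAddCommGroup] at e2 ⊢
        linarith) (by positivity)
    linarith
  · obtain ⟨k, hk⟩ := ((tendsto_integral_lipMajorant (P' := P') f hY.1).eventually
      (gt_mem_nhds ha)).exists
    set b := ∫ ω, lipMajorant f k (Z ω) ∂P' with hb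
    obtain ⟨ε, hε, hkε⟩ : ∃ ε : ℝ, 0 < ε ∧ k * ε < (a - b) / 2 := by
      refine ⟨(a - b) / (2 * (k + 1)), by have := sub_pos.2 hk; positivity, ?_⟩
      have h0 : (0 : ℝ) < a - b := sub_pos.2 hk
      rw [← mul_div_assoc, div_lt_div_iff₀ (by positivity) (by norm_num)]
      nlinarith
    have h1 := hY.2 (lipMajorantBCF f k)
    have h2 := h1.add ((h ε hε).const_mul (2 * ‖f‖))
    have h3 : b + 2 * ‖f‖ * 0 < (a + b) / 2 := by linarith
    filter_upwards [h2.eventually (gt_mem_nhds h3)] with n hn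
    have := outerExpectation_le_add (P := P) (A := {ω | ε < dist (Y' n ω) (Y n ω)})
      (f₁ := fun ω => f (Y' n ω)) (f₂ := fun ω => lipMajorantBCF f k (Y n ω))
      (r := k * ε) (fun ω => f.norm_coe_le_norm _)
      (fun ω => abs_lipMajorant_le f k (Y n ω))
      (fun ω hω => by
        have e1 := lipMajorant_le_add f k (Y' n ω) (Y n ω)
        have e2 := le_lipMajorant f k (Y' n ω)
        have e3 := mul_le_mul_of_nonneg_left (not_lt.1 hω) (Nat.cast_nonneg (α := ℝ) k)
        simp only [lipMajorantBCF, BoundedContinuousFunction.coe_ofNormedAddCommGroup]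
        linarith) (by positivity)
    linarith

end Envelope

/-! ### The modulus of continuity on `ℓ^∞` -/

section Modulus

variable {T : Type*} [PseudoMetricSpace T]

/-- The modulus of continuity `sup {|y a - y b| : dist a b ≤ δ}`. -/
def modulus (δ : ℝ) (y : LInf T) : ℝ := ⨆ q : {q : T × T // dist q.1 q.2 ≤ δ}, |y q.1.1 - y q.1.2|

theorem LInf.abs_apply_le {T : Type*} (y : LInf T) (a : T) : |y a| ≤ ‖y‖ :=
  lp.norm_apply_le_norm ENNReal.top_ne_zero y a

theorem abs_sub_le_modulus {δ : ℝ} (y : LInf T) {a b : T} (h : dist a b ≤ δ) :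
    |y a - y b| ≤ modulus δ y := by
  refine le_ciSup (f := fun q : {q : T × T // dist q.1 q.2 ≤ δ} => |y q.1.1 - y q.1.2|)
    ⟨2 * ‖y‖, ?_⟩ ⟨(a, b), h⟩
  rintro _ ⟨q, rfl⟩
  have h1 := LInf.abs_apply_le y q.1.1
  have h2 := LInf.abs_apply_le y q.1.2
  exact (abs_sub _ _).trans (by linarith)

theorem modulus_nonneg (δ : ℝ) (y : LInf T) : 0 ≤ modulus δ y :=
  Real.iSup_nonneg fun _ => abs_nonneg _

theorem modulus_le_add (δ : ℝ) (y z : LInf T) : modulus δ y ≤ modulus δ z + 2 * dist y z := by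
  -- The bound must also be nonnegative because `T` may be empty, where the supremum is `0` by
  -- convention.
  refine Real.iSup_le (fun q => ?_)
    (add_nonneg (modulus_nonneg δ z) (mul_nonneg zero_le_two dist_nonneg))
  have h0 := abs_sub_le_modulus z q.2
  have h1 := LInf.abs_apply_le (y - z) q.1.1
  have h2 := LInf.abs_apply_le (y - z) q.1.2
  rw [lp.coeFn_sub, Pi.sub_apply, ← dist_eq_norm, abs_le] at h1 h2
  rw [abs_le] at h0 ⊢
  constructor <;> linarith

theorem continuous_modulus (δ : ℝ) : Continuous (modulus δ : LInf T → ℝ) :=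
  (LipschitzWith.of_le_add_mul 2 fun y z => by simpa using modulus_le_add δ y z).continuous

theorem tendsto_modulus [CompactSpace T] {y : LInf T} (hy : Continuous fun a => y a) :
    Tendsto (fun k : ℕ => modulus (1 / ((k : ℝ) + 1)) y) atTop (𝓝 0) := by
  have hu := CompactSpace.uniformContinuous_of_continuous hy
  rw [Metric.tendsto_atTop]
  intro ε hε
  obtain ⟨δ, hδ, H⟩ := Metric.uniformContinuous_iff.1 hu (ε / 2) (half_pos hε)
  obtain ⟨N, hN⟩ := exists_nat_one_div_lt hδ
  refine ⟨N, fun k hk => ?_⟩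
  rw [Real.dist_eq, sub_zero, abs_of_nonneg (modulus_nonneg _ _)]
  refine lt_of_le_of_lt (Real.iSup_le (fun q => ?_) (half_pos hε).le) (half_lt_self hε)
  have hq : dist q.1.1 q.1.2 < δ := by
    refine lt_of_le_of_lt (q.2.trans ?_) hN
    exact one_div_le_one_div_of_le (by positivity) (by gcongr)
  exact (H hq).le

variable {Ω Ω' : Type*} [MeasurableSpace Ω] [MeasurableSpace Ω'] {P : Measure Ω}
  [IsProbabilityMeasure P] {P' : Measure Ω'} [IsProbabilityMeasure P']

/-- Weak convergence to a process with continuous paths implies asymptotic equicontinuity. -/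
theorem WeakConv.exists_modulus_lt [CompactSpace T] {Y : ℕ → Ω → LInf T} {Z : Ω' → LInf T}
    (hY : WeakConv P Y P' Z) (hZ : ∀ᵐ ω ∂P', Continuous fun a : T => Z ω a) {ε η : ℝ}
    (hε : 0 < ε) (hη : 0 < η) :
    ∃ δ : ℝ, 0 < δ ∧ ∀ᶠ n in atTop, P.real {ω | ε ≤ modulus δ (Y n ω)} < η := by
  -- A bounded continuous functional which equals `1` wherever the modulus reaches `ε`, so that weak
  -- convergence applies to it.
  let g : ℕ → LInf T → ℝ := fun k y => min 1 (modulus (1 / ((k : ℝ) + 1)) y / ε)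
  have hg0 : ∀ k y, 0 ≤ g k y := fun k y =>
    le_min zero_le_one (div_nonneg (modulus_nonneg _ _) hε.le)
  have hg1 : ∀ k y, |g k y| ≤ 1 := fun k y => by
    rw [abs_of_nonneg (hg0 k y)]; exact min_le_left _ _
  have hgc : ∀ k, Continuous (g k) := fun k =>
    continuous_const.min ((continuous_modulus _).div_const _)
  have hlim : Tendsto (fun k => ∫ ω, g k (Z ω) ∂P') atTop (𝓝 (∫ _ω, (0 : ℝ) ∂P')) := by
    refine tendsto_integral_of_dominated_convergence (fun _ => 1)
      (fun k => aestronglyMeasurable_comp_of_borel hY.1 (hgc k)) (integrable_const _)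
      (fun k => Eventually.of_forall fun ω => hg1 k _) ?_
    filter_upwards [hZ] with ω hω
    simpa [g] using (tendsto_const_nhds (x := (1 : ℝ))).min ((tendsto_modulus hω).div_const ε)
  rw [integral_zero] at hlim
  obtain ⟨k, hk⟩ := (hlim.eventually (gt_mem_nhds hη)).exists
  refine ⟨1 / ((k : ℝ) + 1), by positivity, ?_⟩
  have hconv := hY.2 (BoundedContinuousFunction.ofNormedAddCommGroup (g k) (hgc k) 1 (hg1 k))
  filter_upwards [hconv.eventually (gt_mem_nhds hk)] with n hn
  refine lt_of_le_of_lt (measureReal_le_outerExpectation (B := 1) (fun ω => hg1 k (Y n ω))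
    (fun ω => hg0 k _) fun ω hω => ?_) hn
  exact le_min le_rfl ((one_le_div hε).2 hω)

end Modulus

/-! ### Regularity of copulas -/

section Regularity

variable {d : ℕ}

/-- Telescoping along the coordinates. -/
theorem abs_sub_sub_sum_le {g : (Fin d → ℝ) → ℝ} {u w a r : Fin d → ℝ}
    (h : ∀ j, ∀ v : Fin d → ℝ, (∀ i, v i = u i ∨ v i = w i) →
      |g (Function.update v j (w j)) - g (Function.update v j (u j)) - a j| ≤ r j) :
    |g w - g u - ∑ j, a j| ≤ ∑ j, r j := by
  classical
  -- The coordinates in `S` have already been switched from `u` to `w`; each intermediate point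
  -- mixes the two, as `h` requires.
  have key : ∀ S : Finset (Fin d),
      |g (S.piecewise w u) - g u - ∑ j ∈ S, a j| ≤ ∑ j ∈ S, r j := by
    intro S
    induction S using Finset.induction_on with
    | empty => simp
    | insert j S hj ih =>
      have h1 := h j (S.piecewise w u) fun i => by
        by_cases hi : i ∈ S
        · exact Or.inr (by simp [hi])
        · exact Or.inl (by simp [hi])
      have h2 : Function.update (S.piecewise w u) j (u j) = S.piecewise w u := by
        rw [Function.update_eq_self_iff]
        simp [hj]
      rw [h2] at h1
      rw [Finset.piecewise_insert, Finset.sum_insert hj, Finset.sum_insert hj]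
      rw [abs_le] at h1 ih ⊢
      constructor <;> linarith
  simpa using key Finset.univ

variable (C : Copula d)

theorem Copula.nonneg (u : Fin d → ℝ) : 0 ≤ C u := measureReal_nonneg

theorem Copula.le_one (u : Fin d → ℝ) : C u ≤ 1 := by
  have := C.isProb
  exact measureReal_le_one

/-- The added mass lies in the slab `a < w j ≤ b`, whose mass is at most `b - a` because the margin
is uniform. -/
theorem Copula.update_le_add (v : Fin d → ℝ) (j : Fin d) {a b : ℝ} (hab : a ≤ b) :
    C (Function.update v j b) ≤ C (Function.update v j a) + (b - a) := by
  have := C.isProb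
  have h1 : C.law.real {w | w j ∈ Set.Ioc a b} ≤ b - a := by
    have e : C.law {w | w j ∈ Set.Ioc a b} =
        volume.restrict (Set.Icc (0 : ℝ) 1) (Set.Ioc a b) := by
      rw [← C.margin j, Measure.map_apply (measurable_pi_apply j) measurableSet_Ioc]
      rfl
    rw [measureReal_def, e]
    refine ENNReal.toReal_le_of_le_ofReal (by linarith) ?_
    exact (Measure.restrict_apply_le _ _).trans (by rw [Real.volume_Ioc])
  refine (measureReal_mono (s₂ := Set.Iic (Function.update v j a) ∪ {w | w j ∈ Set.Ioc a b})
    fun w hw => ?_).trans ((measureReal_union_le _ _).trans (by gcongr))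
  rcases le_or_gt (w j) a with h | h
  · left
    intro i
    by_cases hi : i = j
    · subst hi; simpa using h
    · simpa [hi] using hw i
  · exact Or.inr ⟨h, by simpa using hw j⟩

theorem Copula.update_mono (v : Fin d → ℝ) (j : Fin d) {a b : ℝ} (hab : a ≤ b) :
    C (Function.update v j a) ≤ C (Function.update v j b) := by
  have := C.isProb
  refine measureReal_mono (Set.Iic_subset_Iic.2 ?_)
  exact update_le_update_iff.2 ⟨hab, fun _ _ => le_rfl⟩

theorem Copula.abs_update_sub_le (v : Fin d → ℝ) (j : Fin d) (a b : ℝ) :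
    |C (Function.update v j a) - C (Function.update v j b)| ≤ |a - b| := by
  wlog hab : a ≤ b generalizing a b
  · rw [abs_sub_comm, abs_sub_comm a]
    exact this b a (le_of_not_ge hab)
  have h1 := C.update_le_add v j hab
  have h2 := C.update_mono v j hab
  rw [abs_of_nonpos (by linarith), abs_of_nonpos (by linarith)]
  linarith

theorem Copula.abs_sub_le (w u : Fin d → ℝ) : |C w - C u| ≤ ∑ j, |w j - u j| := by
  have := abs_sub_sub_sum_le (g := fun v => C v) (u := u) (w := w) (a := 0)
    (r := fun j => |w j - u j|)
    fun j v _ => by simpa using C.abs_update_sub_le v j (w j) (u j)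
  simpa using this

theorem Copula.continuous : Continuous fun u => C u := by
  refine (LipschitzWith.of_dist_le_mul (K := (d : NNReal)) fun w u => ?_).continuous
  refine (C.abs_sub_le w u).trans ?_
  calc ∑ j, |w j - u j| ≤ ∑ _j : Fin d, dist w u :=
        Finset.sum_le_sum fun j _ => by simpa [Real.dist_eq] using dist_le_pi_dist w u j
    _ = _ := by simp

theorem dist_sq_le_sum (w u : Fin d → ℝ) : dist w u ^ 2 ≤ ∑ k, (w k - u k) ^ 2 := by
  have h0 : 0 ≤ ∑ k, (w k - u k) ^ 2 := Finset.sum_nonneg fun _ _ => sq_nonneg _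
  have h : dist w u ≤ √(∑ k, (w k - u k) ^ 2) := by
    refine (dist_pi_le_iff (Real.sqrt_nonneg _)).2 fun k => ?_
    rw [Real.dist_eq]
    refine Real.abs_le_sqrt ?_
    exact Finset.single_le_sum (f := fun k => (w k - u k) ^ 2) (fun _ _ => sq_nonneg _)
      (Finset.mem_univ k)
  exact (Real.le_sqrt dist_nonneg h0).1 h

variable {C}

/-- Uniformly over `u` with `u j` away from `0` and `1`, the increments of the copula in the
`j`-th direction are linear up to a small error. -/
theorem exists_abs_increment_sub_le {j : Fin d} {D : (Fin d → ℝ) → ℝ}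
    (hD : ∀ u ∈ cube d, u j ∈ Set.Ioo (0 : ℝ) 1 →
      HasDerivAt (fun r : ℝ => C (Function.update u j r)) (D u) (u j))
    (hDc : ContinuousOn D {u | u ∈ cube d ∧ u j ∈ Set.Ioo (0 : ℝ) 1}) {η ε : ℝ} (hη : 0 < η)
    (hε : 0 < ε) :
    ∀ᶠ δ in 𝓝[>] (0 : ℝ), ∀ u ∈ cube d, u j ∈ Set.Icc η (1 - η) → ∀ w ∈ cube d, dist w u ≤ δ →
      ∀ v : Fin d → ℝ, (∀ i, v i = u i ∨ v i = w i) →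
      |C (Function.update v j (w j)) - C (Function.update v j (u j)) - D u * (w j - u j)| ≤
        ε * |w j - u j| := by
  -- The margin is `η / 2` instead of `η` so that segments of length below `η / 2` starting at `u j`
  -- stay in a compact set where `D` is uniformly continuous.
  set K : Set (Fin d → ℝ) := {u | u ∈ cube d ∧ u j ∈ Set.Icc (η / 2) (1 - η / 2)} with hK
  have hKsub : K ⊆ {u | u ∈ cube d ∧ u j ∈ Set.Ioo (0 : ℝ) 1} := fun u hu =>
    ⟨hu.1, by linarith [hu.2.1], by linarith [hu.2.2]⟩
  have hKc : IsCompact K :=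
    (isCompact_Icc (a := (0 : Fin d → ℝ)) (b := 1)).inter_right
      (isClosed_Icc.preimage (continuous_apply j))
  have hu := hKc.uniformContinuousOn_of_continuous (hDc.mono hKsub)
  obtain ⟨δ₀, hδ₀, H⟩ := Metric.uniformContinuousOn_iff.1 hu ε hε
  filter_upwards [Ioo_mem_nhdsGT (lt_min hδ₀ (half_pos hη))] with δ hδ u hu huj w hw hwu v hv
  have hδ1 : δ < δ₀ := hδ.2.trans_le (min_le_left _ _)
  have hδ2 : δ < η / 2 := hδ.2.trans_le (min_le_right _ _)
  have huK : u ∈ K := ⟨hu, by linarith [huj.1], by linarith [huj.2]⟩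
  have hwj : |w j - u j| ≤ δ := by
    simpa [Real.dist_eq] using (dist_le_pi_dist w u j).trans hwu
  have hmem : ∀ r ∈ Set.uIcc (u j) (w j), Function.update v j r ∈ K ∧
      dist (Function.update v j r) u < δ₀ := by
    intro r hr
    have hru : |r - u j| ≤ δ := (Set.abs_sub_left_of_mem_uIcc hr).trans hwj
    have hr' := abs_le.1 hru
    have hrr : r ∈ Set.Icc (η / 2) (1 - η / 2) := ⟨by linarith [huj.1], by linarith [huj.2]⟩
    refine ⟨⟨⟨fun i => ?_, fun i => ?_⟩, by simpa using hrr⟩, ?_⟩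
    · by_cases hi : i = j
      · subst hi; simpa using (half_pos hη).le.trans hrr.1
      · rcases hv i with h | h
        · simpa [hi, h] using hu.1 i
        · simpa [hi, h] using hw.1 i
    · by_cases hi : i = j
      · subst hi; simpa using hrr.2.trans (by linarith)
      · rcases hv i with h | h
        · simpa [hi, h] using hu.2 i
        · simpa [hi, h] using hw.2 i
    · refine lt_of_le_of_lt ((dist_pi_le_iff hδ.1.le).2 fun i => ?_) hδ1
      by_cases hi : i = j
      · subst hi; simpa [Real.dist_eq] using hru
      · rcases hv i with h | h
        · simpa [hi, h] using hδ.1.le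
        · simpa [hi, h] using (dist_le_pi_dist w u i).trans hwu
  -- Subtracting the linear function `D u * r` leaves a derivative of size at most `ε`; the mean
  -- value inequality then gives the claim.
  have hder : ∀ r ∈ Set.uIcc (u j) (w j), HasDerivWithinAt
      (fun r => C (Function.update v j r) - D u * r) (D (Function.update v j r) - D u)
      (Set.uIcc (u j) (w j)) r := by
    intro r hr
    have h1 := hD _ (hmem r hr).1.1 (hKsub (hmem r hr).1).2
    simp only [Function.update_idem, Function.update_self] at h1
    have h2 := (h1.sub ((hasDerivAt_id r).const_mul (D u))).hasDerivWithinAt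
      (s := Set.uIcc (u j) (w j))
    rw [mul_one] at h2
    exact h2
  have hbd : ∀ r ∈ Set.uIcc (u j) (w j), ‖D (Function.update v j r) - D u‖ ≤ ε := fun r hr =>
    (H _ (hmem r hr).1 _ huK (hmem r hr).2).le
  have := (convex_uIcc (u j) (w j)).norm_image_sub_le_of_norm_hasDerivWithin_le hder hbd
    Set.left_mem_uIcc Set.right_mem_uIcc
  rw [Real.norm_eq_abs, Real.norm_eq_abs] at this
  convert this using 2
  ring

theorem abs_partial_le_one {j : Fin d} {u : Fin d → ℝ} {D : ℝ}
    (hD : HasDerivAt (fun r : ℝ => C (Function.update u j r)) D (u j)) : |D| ≤ 1 := by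
  have hL : LipschitzWith 1 fun r : ℝ => C (Function.update u j r) :=
    LipschitzWith.of_dist_le_mul fun a b => by
      simpa [Real.dist_eq] using C.abs_update_sub_le u j a b
  have := norm_deriv_le_of_lipschitz (x₀ := u j) hL
  rwa [hD.deriv] at this

/-- A uniform second order bound: up to a linear term, the increments of the copula are bounded by
quadratic terms, with small coefficients for the dominant ones. -/
theorem exists_linear_approx (hC : HasSmoothPartials C) {η : ℝ} (hη : 0 < η) :
    ∃ K : ℝ, 0 ≤ K ∧ ∀ u ∈ cube d, ∃ a b : Fin d → ℝ,
      (∀ j, 0 ≤ b j ∧ b j * (u j * (1 - u j)) ≤ η) ∧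
      ∀ c : ℝ, 0 < c → ∀ w ∈ cube d, |C w - C u - ∑ j, a j * (w j - u j)| ≤
        ∑ j, (c + b j / c * (w j - u j) ^ 2 + K * ∑ k, (w k - u k) ^ 2) := by
  choose D hD hDc using hC
  have hsq : (0 : ℝ) < √η := Real.sqrt_pos.2 hη
  obtain ⟨δ, H, hδ⟩ := ((eventually_all.2 fun j =>
    exists_abs_increment_sub_le (hD j) (hDc j) hη hsq).and self_mem_nhdsWithin).exists
  have hδ0 : 0 < δ := hδ
  classical
  -- Near a face the linear coefficient is dropped and `b j = 1`, which is affordable since `u j *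
  -- (1 - u j) ≤ η` there. Elsewhere the derivative is used and `b j = η`.
  refine ⟨2 / δ, by positivity, fun u hu => ⟨fun j => if u j ∈ Set.Icc η (1 - η) then D j u else 0,
    fun j => if u j ∈ Set.Icc η (1 - η) then η else 1, fun j => ?_, fun c hc w hw => ?_⟩⟩
  · have h0 : 0 ≤ u j := hu.1 j
    have h1 : u j ≤ 1 := hu.2 j
    have h2 : 0 ≤ u j * (1 - u j) := mul_nonneg h0 (by linarith)
    dsimp only
    split_ifs with h
    · exact ⟨hη.le, mul_le_of_le_one_right hη.le (by nlinarith)⟩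
    · refine ⟨zero_le_one, ?_⟩
      rw [Set.mem_Icc, not_and_or, not_le, not_le] at h
      rcases h with h | h <;> nlinarith
  · refine abs_sub_sub_sum_le (g := fun v => C v) fun j v hv => ?_
    -- Turns a linear error into a quadratic one, so that it can be integrated against a variance;
    -- `c` stays free and is later tuned to the sample size.
    have hamgm : ∀ β x : ℝ, 0 ≤ β → √β * |x| ≤ c + β / c * x ^ 2 := by
      intro β x hβ
      have h1 := Real.sq_sqrt hβ
      have h2 := sq_abs x
      have h3 : c + β / c * x ^ 2 - √β * |x| = ((c - √β * |x|) ^ 2 + c * (√β * |x|)) / c := by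
        field_simp
        rw [← h2, sub_sq, mul_pow, h1]
        ring
      have h4 : 0 ≤ ((c - √β * |x|) ^ 2 + c * (√β * |x|)) / c := by positivity
      linarith
    have hQ : 0 ≤ ∑ k, (w k - u k) ^ 2 := Finset.sum_nonneg fun _ _ => sq_nonneg _
    have hlip := C.abs_update_sub_le v j (w j) (u j)
    have hKQ : 0 ≤ 2 / δ * ∑ k, (w k - u k) ^ 2 := by positivity
    dsimp only at hlip ⊢
    split_ifs with h
    · rcases le_or_gt (dist w u) δ with hwu | hwu
      · have h1 := H j u hu h w hw hwu v hv
        have h2 := hamgm η (w j - u j) hη.le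
        linarith
      -- Far from `u` linearisation fails, but the error is at most `2 * dist w u`, hence at most `2
      -- / δ * dist w u ^ 2`. This is where `K = 2 / δ` comes from.
      · have hlt : u j ∈ Set.Ioo (0 : ℝ) 1 := ⟨by linarith [h.1], by linarith [h.2]⟩
        have h1 := mul_le_mul_of_nonneg_right (abs_partial_le_one (hD j u hu hlt))
          (abs_nonneg (w j - u j))
        rw [← abs_mul] at h1
        have h2 : |w j - u j| ≤ dist w u := by
          simpa [Real.dist_eq] using dist_le_pi_dist w u j
        have h3 := dist_sq_le_sum w u
        have h4 : 2 * dist w u ≤ 2 / δ * ∑ k, (w k - u k) ^ 2 := by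
          rw [div_mul_eq_mul_div, le_div_iff₀ hδ0]
          nlinarith [dist_nonneg (x := w) (y := u)]
        have h5 : 0 ≤ c + η / c * (w j - u j) ^ 2 := by positivity
        refine (abs_sub _ _).trans ?_
        linarith
    · have h2 := hamgm 1 (w j - u j) zero_le_one
      rw [Real.sqrt_one, one_mul] at h2
      rw [zero_mul, sub_zero]
      linarith

end Regularity

/-! ### Integration against the smoothing laws -/

section Smoothing

variable {d : ℕ} {ν : SmoothingFamily d} {m : ℕ} {x : Fin m → Fin d → ℝ} {u : Fin d → ℝ}

theorem memLp_coord (hm : 1 ≤ m) (hu : u ∈ cube d) (j : Fin d) :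
    MemLp (fun w : Fin d → ℝ => w j) 2 (ν.law m x u) := by
  have := ν.isProb m hm x u hu
  refine MemLp.of_bound (measurable_pi_apply j).aestronglyMeasurable 1 ?_
  filter_upwards [ν.support m hm x u hu] with w hw
  have h0 : 0 ≤ w j := hw.1 j
  rw [Real.norm_eq_abs, abs_of_nonneg h0]
  exact hw.2 j

theorem integrable_sub_coord (hm : 1 ≤ m) (hu : u ∈ cube d) (j : Fin d) :
    Integrable (fun w : Fin d → ℝ => w j - u j) (ν.law m x u) := by
  have := ν.isProb m hm x u hu
  exact ((memLp_coord hm hu j).integrable one_le_two).sub (integrable_const _)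

theorem integral_sub_coord (hm : 1 ≤ m) (hu : u ∈ cube d) (j : Fin d) :
    ∫ w, (w j - u j) ∂(ν.law m x u) = 0 := by
  have := ν.isProb m hm x u hu
  rw [integral_sub ((memLp_coord hm hu j).integrable one_le_two) (integrable_const _),
    ν.mean m hm x u hu j]
  simp

theorem integrable_sq_coord (hm : 1 ≤ m) (hu : u ∈ cube d) (j : Fin d) :
    Integrable (fun w : Fin d → ℝ => (w j - u j) ^ 2) (ν.law m x u) := by
  have := ν.isProb m hm x u hu
  exact ((memLp_coord hm hu j).sub (memLp_const (u j))).integrable_sq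

theorem integral_sq_coord (hm : 1 ≤ m) (hu : u ∈ cube d) (j : Fin d) :
    ∫ w, (w j - u j) ^ 2 ∂(ν.law m x u) = variance (fun w : Fin d → ℝ => w j) (ν.law m x u) := by
  rw [variance_eq_integral (measurable_pi_apply j).aemeasurable, ν.mean m hm x u hu j]

/-- Integrating a quadratic bound. -/
theorem abs_integral_le_of_quadratic (hm : 1 ≤ m) (hu : u ∈ cube d) {g : (Fin d → ℝ) → ℝ}
    {A : ℝ} {B V : Fin d → ℝ} (hB : ∀ j, 0 ≤ B j)
    (hV : ∀ j, variance (fun w : Fin d → ℝ => w j) (ν.law m x u) ≤ V j)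
    (hg : ∀ w ∈ cube d, |g w| ≤ A + ∑ j, B j * (w j - u j) ^ 2) :
    |∫ w, g w ∂(ν.law m x u)| ≤ A + ∑ j, B j * V j := by
  have := ν.isProb m hm x u hu
  have hi : ∀ j ∈ Finset.univ, Integrable (fun w : Fin d → ℝ => B j * (w j - u j) ^ 2)
      (ν.law m x u) := fun j _ => (integrable_sq_coord hm hu j).const_mul _
  have h1 : ‖∫ w, g w ∂(ν.law m x u)‖ ≤ ∫ w, (A + ∑ j, B j * (w j - u j) ^ 2) ∂(ν.law m x u) := by
    refine norm_integral_le_of_norm_le ((integrable_const A).add (integrable_finsetSum _ hi)) ?_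
    filter_upwards [ν.support m hm x u hu] with w hw using hg w hw
  refine h1.trans ?_
  rw [integral_add (integrable_const A) (integrable_finsetSum _ hi), integral_finsetSum _ hi]
  simp only [integral_const, probReal_univ, smul_eq_mul, one_mul, integral_const_mul,
    integral_sq_coord hm hu]
  gcongr with j
  · exact hB j
  · exact hV j

theorem measurable_empCopula : Measurable (empCopula x) := by
  unfold empCopula
  refine measurable_const.mul (Finset.measurable_fun_sum _ fun i _ => ?_)
  refine Measurable.ite ?_ measurable_const measurable_const
  simp only [Set.ofPred_forall]
  exact MeasurableSet.iInter fun j => measurableSet_le measurable_const (measurable_pi_apply j)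

theorem integrable_empCopula (hm : 1 ≤ m) (hu : u ∈ cube d) :
    Integrable (empCopula x) (ν.law m x u) := by
  have := ν.isProb m hm x u hu
  exact Integrable.of_bound measurable_empCopula.aestronglyMeasurable 1
    (Eventually.of_forall fun w => abs_empCopula_le x w)

theorem Copula.abs_le_one (C : Copula d) (w : Fin d → ℝ) : |C w| ≤ 1 := by
  rw [abs_of_nonneg (C.nonneg w)]; exact C.le_one w

theorem integrable_copula (C : Copula d) (hm : 1 ≤ m) (hu : u ∈ cube d) :
    Integrable (fun w => C w) (ν.law m x u) := by
  have := ν.isProb m hm x u hu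
  exact Integrable.of_bound C.continuous.aestronglyMeasurable 1
    (Eventually.of_forall fun w => C.abs_le_one w)

/-- The bias `∫ C dν - C(u)` of smoothing is `o(√n / m)`, uniformly in samples of size `m ≤ n`. -/
theorem eventually_bias_le {C : Copula d} (hC : HasSmoothPartials C) (hν : VarianceCondition ν)
    {ε : ℝ} (hε : 0 < ε) :
    ∀ᶠ n : ℕ in atTop, ∀ m : ℕ, 1 ≤ m → m ≤ n → ∀ (x : Fin m → Fin d → ℝ), ∀ u ∈ cube d,
      m / √n * |∫ w, (C w - C u) ∂(ν.law m x u)| ≤ ε := by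
  obtain ⟨κ, hκ, hvar⟩ := hν
  set γ : ℝ := ε / (3 * (d + 1)) with hγ
  have hγ0 : 0 < γ := by positivity
  have hγd : d * γ ≤ ε / 3 := by
    rw [hγ, ← mul_div_assoc, div_le_div_iff₀ (by positivity) (by norm_num)]
    nlinarith
  set η : ℝ := γ ^ 2 / κ with hη
  obtain ⟨K, hK, H⟩ := exists_linear_approx hC (show 0 < η by positivity)
  have hlim : Tendsto (fun n : ℕ => d * (d * (K * κ)) * (√(n : ℝ))⁻¹) atTop (𝓝 0) := by
    simpa using ((Real.tendsto_sqrt_atTop.comp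
      (tendsto_natCast_atTop_atTop (R := ℝ))).inv_tendsto_atTop).const_mul (d * (d * (K * κ)) : ℝ)
  filter_upwards [hlim.eventually (ge_mem_nhds (show 0 < ε / 3 by positivity))]
    with n hn m hm hmn x u hu
  have := ν.isProb m hm x u hu
  obtain ⟨a, b, hb, hab⟩ := H u hu
  have hm0 : (0 : ℝ) < m := by exact_mod_cast hm
  have hn0 : (0 : ℝ) < n := hm0.trans_le (by exact_mod_cast hmn)
  obtain ⟨q, hq⟩ : ∃ q, q = √(m : ℝ) := ⟨_, rfl⟩
  have hsm : 0 < q := hq ▸ Real.sqrt_pos.2 hm0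
  have hsn : 0 < √(n : ℝ) := Real.sqrt_pos.2 hn0
  have hsmn : q ≤ √(n : ℝ) := hq ▸ Real.sqrt_le_sqrt (by exact_mod_cast hmn)
  have hsm2 : q ^ 2 = m := hq ▸ Real.sq_sqrt hm0.le
  -- This balances the two errors: as `κ * η = γ ^ 2 = c ^ 2 * m`, the quadratic term with
  -- coefficient `b j / c` integrates to at most `c`.
  set c : ℝ := γ / q with hc
  have hc0 : 0 < c := by positivity
  -- The linear correction is free, because the smoothing law has mean `u`.
  have hlin : ∫ w, (C w - C u) ∂(ν.law m x u) =
      ∫ w, (C w - C u - ∑ j, a j * (w j - u j)) ∂(ν.law m x u) := by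
    have hi : ∀ j ∈ Finset.univ, Integrable (fun w : Fin d → ℝ => a j * (w j - u j))
      (ν.law m x u) := fun j _ => (integrable_sub_coord hm hu j).const_mul _
    rw [integral_sub (f := fun w => C w - C u) ((integrable_copula C hm hu).sub (integrable_const _))
      (integrable_finsetSum _ hi), integral_finsetSum _ hi]
    simp [integral_const_mul, integral_sub_coord hm hu]
  have hbound := abs_integral_le_of_quadratic (ν := ν) (x := x) hm hu
    (g := fun w => C w - C u - ∑ j, a j * (w j - u j)) (A := d * c)
    (B := fun j => b j / c + d * K) (fun j => by have := (hb j).1; positivity)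
    (fun j => hvar m hm x u hu j) (fun w hw => (hab c hc0 w hw).trans_eq (by
      simp only [Finset.sum_add_distrib, add_mul, Finset.sum_const, Finset.card_univ,
        Fintype.card_fin, nsmul_eq_mul, ← Finset.mul_sum]
      ring))
  have hterm : ∀ j, (b j / c + d * K) * (κ * u j * (1 - u j) / m) ≤ c + d * K * κ / m := by
    intro j
    have h0 : 0 ≤ u j := hu.1 j
    have h1 : u j ≤ 1 := hu.2 j
    have h2 : b j / c * (κ * u j * (1 - u j) / m) ≤ c := by
      have e : b j / c * (κ * u j * (1 - u j) / m) =
          κ * (b j * (u j * (1 - u j))) / (c * m) := by field_simp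
      rw [e, div_le_iff₀ (by positivity)]
      calc κ * (b j * (u j * (1 - u j))) ≤ κ * η := mul_le_mul_of_nonneg_left (hb j).2 hκ.le
        _ = γ ^ 2 := by rw [hη]; field_simp
        _ = c * (c * m) := by rw [hc, ← hsm2]; field_simp
    have h3 : d * K * (κ * u j * (1 - u j) / m) ≤ d * K * κ / m := by
      rw [mul_div_assoc (d * K : ℝ) κ]
      have : κ * u j * (1 - u j) ≤ κ := by
        rw [mul_assoc]
        exact mul_le_of_le_one_right hκ.le (by nlinarith)
      exact mul_le_mul_of_nonneg_left (div_le_div_of_nonneg_right this hm0.le) (by positivity)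
    rw [add_mul]
    exact add_le_add h2 h3
  have hsum := Finset.sum_le_sum fun j (_ : j ∈ Finset.univ) => hterm j
  rw [Finset.sum_const, Finset.card_univ, Fintype.card_fin, nsmul_eq_mul] at hsum
  rw [hlin]
  -- Since `q = √m ≤ √n`, the first term is at most `2 * (d * γ)`, and the second vanishes as `n`
  -- grows, whatever `m` is.
  have hfin : m / √n * (d * c + d * (c + d * K * κ / m)) =
      2 * (d * γ) * (q / √n) + d * (d * (K * κ)) * (√n)⁻¹ := by
    rw [hc, ← hsm2]
    field_simp
    ring
  calc m / √n * |∫ w, (C w - C u - ∑ j, a j * (w j - u j)) ∂(ν.law m x u)|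
      ≤ m / √n * (d * c + d * (c + d * K * κ / m)) := by
        gcongr
        linarith
    _ ≤ 2 * (d * γ) * 1 + ε / 3 := by
        rw [hfin]
        gcongr
        exact div_le_one_of_le₀ hsmn hsn.le
    _ ≤ ε := by linarith

end Smoothing

/-! ### Comparison of the two processes -/

section Comparison

variable {d : ℕ}

instance : CompactSpace ↥Delta := by
  refine isCompact_iff_compactSpace.1 ?_
  refine (isCompact_Icc (a := ((0, 0) : ℝ × ℝ)) (b := (1, 1))).of_isClosed_subset ?_ ?_
  · exact (isClosed_le continuous_const continuous_fst).inter
      ((isClosed_le continuous_fst continuous_snd).inter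
        (isClosed_le continuous_snd continuous_const))
  · rintro ⟨s, t⟩ ⟨h0, h1, h2⟩
    exact ⟨⟨h0, h0.trans h1⟩, ⟨h1.trans h2, h2⟩⟩

instance : CompactSpace ↥(cube d) := isCompact_iff_compactSpace.1 isCompact_Icc

theorem abs_empCopula_sub_copula_le {m : ℕ} (x : Fin m → Fin d → ℝ) (C : Copula d)
    (w : Fin d → ℝ) : |empCopula x w - C w| ≤ 2 := by
  have h1 := abs_empCopula_le x w
  have h2 := C.abs_le_one w
  exact (abs_sub _ _).trans (by linarith)

theorem lam_eq_length_div (n : ℕ) (p : ↥Delta) :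
    lam n p.1.1 p.1.2 = ((⌊n * p.1.2⌋₊ + 1 - (⌊n * p.1.1⌋₊ + 1) : ℕ) : ℝ) / n := by
  have h : ⌊n * p.1.1⌋₊ ≤ ⌊n * p.1.2⌋₊ :=
    Nat.floor_le_floor (mul_le_mul_of_nonneg_left p.2.2.1 (Nat.cast_nonneg n))
  rw [lam, Nat.add_sub_add_right, Nat.cast_sub h]

theorem length_le (n : ℕ) (p : ↥Delta) : ⌊n * p.1.2⌋₊ + 1 - (⌊n * p.1.1⌋₊ + 1) ≤ n := by
  have h : ⌊n * p.1.2⌋₊ ≤ n := by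
    refine Nat.floor_le_of_le (mul_le_of_le_one_right (Nat.cast_nonneg n) p.2.2.2)
  omega

/-- The effect of smoothing a centred empirical copula, in terms of its oscillation. -/
theorem abs_integral_centred_le {ν : SmoothingFamily d} {m : ℕ} (hm : 1 ≤ m)
    {x : Fin m → Fin d → ℝ} {C : Copula d} {u : Fin d → ℝ} (hu : u ∈ cube d) {κ δ A : ℝ}
    (hδ : 0 < δ) (hA : 0 ≤ A) (hκ : 0 ≤ κ)
    (hvar : ∀ j, variance (fun w : Fin d → ℝ => w j) (ν.law m x u) ≤ κ * u j * (1 - u j) / m)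
    (hosc : ∀ w ∈ cube d, dist w u ≤ δ →
      |(empCopula x w - C w) - (empCopula x u - C u)| ≤ A) :
    |∫ w, ((empCopula x w - C w) - (empCopula x u - C u)) ∂(ν.law m x u)| ≤
      A + d * (4 / δ ^ 2 * (κ / m)) := by
  have hV : ∀ j, variance (fun w : Fin d → ℝ => w j) (ν.law m x u) ≤ κ / m := fun j => by
    have h0 : 0 ≤ u j := hu.1 j
    have h1 : u j ≤ 1 := hu.2 j
    refine (hvar j).trans (div_le_div_of_nonneg_right ?_ (Nat.cast_nonneg m))
    rw [mul_assoc]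
    exact mul_le_of_le_one_right hκ (by nlinarith)
  refine (abs_integral_le_of_quadratic hm hu (A := A) (B := fun _ => 4 / δ ^ 2)
    (fun _ => by positivity) hV fun w hw => ?_).trans_eq (by simp)
  rw [← Finset.mul_sum]
  rcases le_or_gt (dist w u) δ with h | h
  · have h1 : 0 ≤ ∑ k, (w k - u k) ^ 2 := Finset.sum_nonneg fun _ _ => sq_nonneg _
    have h2 : 0 ≤ 4 / δ ^ 2 * ∑ k, (w k - u k) ^ 2 := by positivity
    linarith [hosc w hw h]
  -- Outside the `δ`-ball the trivial bound `2 + 2 = 4` is absorbed by the quadratic term, as in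
  -- Chebyshev's inequality.
  · have h1 : δ ^ 2 ≤ ∑ k, (w k - u k) ^ 2 :=
      (pow_le_pow_left₀ hδ.le h.le 2).trans (dist_sq_le_sum w u)
    have h2 : 4 ≤ 4 / δ ^ 2 * ∑ k, (w k - u k) ^ 2 := by
      rw [div_mul_eq_mul_div, le_div_iff₀ (by positivity)]
      linarith
    have h3 := abs_empCopula_sub_copula_le x C w
    have h4 := abs_empCopula_sub_copula_le x C u
    exact (abs_sub _ _).trans (by linarith)

theorem smoothEmpCopula_sub_eq {ν : SmoothingFamily d} {m : ℕ} (hm : 1 ≤ m)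
    (x : Fin m → Fin d → ℝ) (C : Copula d) {u : Fin d → ℝ} (hu : u ∈ cube d) :
    smoothEmpCopula ν x u - empCopula x u =
      ∫ w, ((empCopula x w - C w) - (empCopula x u - C u)) ∂(ν.law m x u) +
        ∫ w, (C w - C u) ∂(ν.law m x u) := by
  have := ν.isProb m hm x u hu
  have h1 := integrable_empCopula (ν := ν) (x := x) hm hu
  have h2 := integrable_copula (ν := ν) (x := x) C hm hu
  rw [integral_sub (f := fun w => empCopula x w - C w) (h1.sub h2) (integrable_const _),
    integral_sub h1 h2, integral_sub h2 (integrable_const _), smoothEmpCopula]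
  simp only [integral_const, probReal_univ, smul_eq_mul, one_mul]
  ring

variable {Ω : Type*}

/-- Uniformly over sample points, the two processes differ by at most the modulus of continuity of
the unsmoothed one plus a deterministic null sequence. -/
theorem eventually_abs_sub_le (X : ℤ → Ω → Fin d → ℝ) {C : Copula d} (hC : HasSmoothPartials C)
    {ν : SmoothingFamily d} (hν : VarianceCondition ν) {δ ε : ℝ} (hδ : 0 < δ) (hε : 0 < ε) :
    ∀ᶠ n : ℕ in atTop, ∀ ω, ∀ τ : Idx d,
      |seqSmoothCop X C ν n ω τ - seqEmpCop X C n ω τ| ≤ modulus δ (seqEmpCop X C n ω) + ε := by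
  have hbias := eventually_bias_le hC hν (half_pos hε)
  obtain ⟨κ, hκ, hvar⟩ := hν
  have hlim : Tendsto (fun n : ℕ => d * (4 / δ ^ 2 * κ) * (√(n : ℝ))⁻¹) atTop (𝓝 0) := by
    simpa using ((Real.tendsto_sqrt_atTop.comp
      (tendsto_natCast_atTop_atTop (R := ℝ))).inv_tendsto_atTop).const_mul (d * (4 / δ ^ 2 * κ) : ℝ)
  filter_upwards [hbias, hlim.eventually (ge_mem_nhds (half_pos hε)), eventually_ge_atTop 1]
    with n hn hn' hn1 ω ⟨p, u, hu⟩
  have hlam := lam_eq_length_div n p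
  have hmod := modulus_nonneg δ (seqEmpCop X C n ω)
  have hlen := length_le n p
  -- Both points share the same `(s,t)`, hence the same sample, so only the oscillation in `u`
  -- enters.
  have hosc : ∀ w (hw : w ∈ cube d), dist w u ≤ δ →
      |seqEmpCop X C n ω (p, ⟨w, hw⟩) - seqEmpCop X C n ω (p, ⟨u, hu⟩)| ≤
        modulus δ (seqEmpCop X C n ω) := fun w hw h =>
    abs_sub_le_modulus _ (by
      rw [Prod.dist_eq, dist_self]
      exact max_le hδ.le h)
  simp only [seqSmoothCop, seqEmpCop] at hosc ⊢
  change |√n * lam n p.1.1 p.1.2 * (smoothEmpCopula ν (stretch X (⌊n * p.1.1⌋₊ + 1)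
      ⌊n * p.1.2⌋₊ ω) u - C u) - √n * lam n p.1.1 p.1.2 * (empCopula (stretch X
      (⌊n * p.1.1⌋₊ + 1) ⌊n * p.1.2⌋₊ ω) u - C u)| ≤ modulus δ (seqEmpCop X C n ω) + ε
  change ∀ w (hw : w ∈ cube d), dist w u ≤ δ →
    |√n * lam n p.1.1 p.1.2 * (empCopula (stretch X (⌊n * p.1.1⌋₊ + 1)
      ⌊n * p.1.2⌋₊ ω) w - C w) - √n * lam n p.1.1 p.1.2 * (empCopula (stretch X
      (⌊n * p.1.1⌋₊ + 1) ⌊n * p.1.2⌋₊ ω) u - C u)| ≤ modulus δ (seqEmpCop X C n ω) at hosc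
  -- The type of the sample depends on its length, so the sample is generalised before the length
  -- `m`.
  generalize stretch X (⌊n * p.1.1⌋₊ + 1) ⌊n * p.1.2⌋₊ ω = x at hosc ⊢
  generalize modulus δ (seqEmpCop X C n ω) = M at hmod hosc ⊢
  generalize ⌊n * p.1.2⌋₊ + 1 - (⌊n * p.1.1⌋₊ + 1) = m at x hosc hlam hlen ⊢
  have hn0 : (0 : ℝ) < n := by exact_mod_cast hn1
  have hsn : 0 < √(n : ℝ) := Real.sqrt_pos.2 hn0
  have hc : √n * lam n p.1.1 p.1.2 = m / √n := by
    rw [hlam]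
    field_simp
    rw [Real.sq_sqrt hn0.le, mul_comm]
  rw [hc] at hosc ⊢
  -- For an empty stretch the factor `m / √n` vanishes; no smoothing law is available in that case.
  rcases Nat.eq_zero_or_pos m with rfl | hm
  · simp only [Nat.cast_zero, zero_div, zero_mul, sub_zero, abs_zero]
    positivity
  have hm0 : (0 : ℝ) < m := by exact_mod_cast hm
  have hfac : (0 : ℝ) < m / √n := by positivity
  -- The modulus `M` bounds the rescaled oscillation, hence the division by `m / √n`.
  have h1 := abs_integral_centred_le hm hu (C := C) (ν := ν) (A := M / (m / √n)) hδ (by positivity)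
    hκ.le (hvar m hm x u hu) fun w hw h => by
      have := hosc w hw h
      rwa [← mul_sub, abs_mul, abs_of_pos hfac, ← le_div_iff₀' hfac] at this
  have h2 := hn m hm hlen x u hu
  rw [← mul_sub, sub_sub_sub_cancel_right, smoothEmpCopula_sub_eq hm x C hu, abs_mul,
    abs_of_pos hfac]
  have h3 : m / √n * (M / (m / √n) + d * (4 / δ ^ 2 * (κ / m))) =
      M + d * (4 / δ ^ 2 * κ) * (√(n : ℝ))⁻¹ := by
    field_simp
  have h4 := mul_le_mul_of_nonneg_left h1 hfac.le
  have h5 := mul_le_mul_of_nonneg_left (abs_add_le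
    (∫ w, ((empCopula x w - C w) - (empCopula x u - C u)) ∂(ν.law m x u))
    (∫ w, (C w - C u) ∂(ν.law m x u))) hfac.le
  rw [mul_add] at h5
  linarith

end Comparison

end SmoothCopula

end

/-! ### Uniform negligibility of smoothing and the weak limit -/

theorem theorem1 {d : ℕ}
    {Ω : Type*} [MeasurableSpace Ω] (P : Measure Ω) [IsProbabilityMeasure P]
    -- a stationary series with continuous margins and copula `C`
    (X : ℤ → Ω → Fin d → ℝ) (hXmeas : ∀ i, Measurable (X i))
    (hXstat : SmoothCopula.IsStationary P X)
    (hXcont : ∀ j : Fin d, Continuous fun r : ℝ => P.real {ω | X 1 ω j ≤ r})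
    (C : SmoothCopula.Copula d)
    (hXC : ∀ x : Fin d → ℝ,
      P.real {ω | ∀ j, X 1 ω j ≤ x j} = C fun j => P.real {ω | X 1 ω j ≤ x j})
    (hC : SmoothCopula.HasSmoothPartials C)
    -- smoothing laws
    (ν : SmoothCopula.SmoothingFamily d) (hν : SmoothCopula.VarianceCondition ν)
    -- the weak limit of the classical process
    {Ω' : Type*} [MeasurableSpace Ω'] (P' : Measure Ω') [IsProbabilityMeasure P']
    (Z : Ω' → SmoothCopula.LInf (SmoothCopula.Idx d))
    (hZcont : ∀ᵐ ω' ∂P', Continuous fun τ : SmoothCopula.Idx d => Z ω' τ)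
    (hconv : SmoothCopula.WeakConv P (SmoothCopula.seqEmpCop X C) P' Z) :
    (∀ ε : ℝ, 0 < ε →
      Tendsto (fun n : ℕ => P {ω | ε < ⨆ τ : SmoothCopula.Idx d,
        |SmoothCopula.seqSmoothCop X C ν n ω τ - SmoothCopula.seqEmpCop X C n ω τ|})
        atTop (𝓝 0)) ∧
    SmoothCopula.WeakConv P (SmoothCopula.seqSmoothCop X C ν) P' Z := by
  have hsup : ∀ n ω, dist (SmoothCopula.seqSmoothCop X C ν n ω) (SmoothCopula.seqEmpCop X C n ω) =
      ⨆ τ : SmoothCopula.Idx d,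
        |SmoothCopula.seqSmoothCop X C ν n ω τ - SmoothCopula.seqEmpCop X C n ω τ| := fun n ω => by
    rw [dist_eq_norm, lp.norm_eq_ciSup]
    simp [Real.norm_eq_abs]
  have key : ∀ ε : ℝ, 0 < ε → Tendsto (fun n : ℕ => P.real {ω | ε < dist
      (SmoothCopula.seqSmoothCop X C ν n ω) (SmoothCopula.seqEmpCop X C n ω)}) atTop (𝓝 0) := by
    intro ε hε
    refine tendsto_order.2 ⟨fun a ha => Eventually.of_forall fun n => ha.trans_le measureReal_nonneg,
      fun η hη => ?_⟩
    obtain ⟨δ, hδ, H⟩ := hconv.exists_modulus_lt hZcont (half_pos hε) hη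
    filter_upwards [H, SmoothCopula.eventually_abs_sub_le X hC hν hδ (half_pos hε)] with n hn hle
    refine (measureReal_mono fun ω hω => ?_).trans_lt hn
    -- If the modulus were below `ε / 2`, the uniform distance would be below `ε / 2 + ε / 2`.
    by_contra hlt
    rw [Set.mem_ofPred_eq, not_le] at hlt
    rw [Set.mem_ofPred_eq, hsup] at hω
    have h0 := SmoothCopula.modulus_nonneg δ (SmoothCopula.seqEmpCop X C n ω)
    have := Real.iSup_le (hle ω) (by positivity)
    linarith
  refine ⟨fun ε hε => ?_, hconv.of_dist_tendsto key⟩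
  have := key ε hε
  simp only [hsup] at this
  rw [← ENNReal.tendsto_toReal_iff (fun n => measure_ne_top P _) ENNReal.zero_ne_top]
  simpa [measureReal_def] using this
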